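/- Let $\mathcal C$ be a rigid C*-tensor category (closed under finite direct sums and subobjects) with simple tensor unit $\mathbb 1$. Let $\mathrm{Irr}\ni\mathbb 1$ be any set of representatives of the isomorphism classes of simple objects, and fix for each $w\in\mathrm{Irr}$ a conjugate $\bar w$ and a standard solution $R_w:\mathbb 1\to\bar w\otimes w$, $\bar R_w:\mathbb 1\to w\otimes\bar w$ of the conjugate equations. For simplicity of notation $\mathcal C$ is written as if strict. Let $$\mathcal A=\bigoplus_{x,y\in\mathrm{Irr}}\mathcal A_{x,y},\qquad \mathcal A_{x,y}=\bigoplus_{w\in\mathrm{Irr}}\mathcal A_{x,y}^w,\qquad \mathcal A_{x,y}^w=\mathcal C(w\otimes x,\,y\otimes w),$$ be the tube algebra of $\mathcal C$. For an object $z$, simple $x,y\in\mathrm{Irr}$ and $\gamma\in\mathcal C(z\otimes x,y\otimes z)$ let $\Psi^z_{x,y}(\gamma)\in\mathcal A_{x,y}$ be the element with components $$\Psi^z_{x,y}(\gamma)_w=\sum_{\alpha}(1_y\otimes\alpha^*)\,\gamma\,(\alpha\otimes 1_x)\qquad(w\in\mathrm{Irr}),$$ where $\alpha$ runs through an orthonormal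 basis of $\mathcal C(w,z)$ for the inner product $\tau^*\sigma=\langle\sigma,\tau\rangle 1_w$. The product and the involution of $\mathcal A$ are the bilinear and the conjugate-linear map determined by $$\gamma_1\cdot\gamma_2=\delta_{x_1,y_2}\,\Psi^{m\otimes l}_{x_2,y_1}\big((\gamma_1\otimes 1_l)(1_m\otimes\gamma_2)\big)\qquad(\gamma_1\in\mathcal A^m_{x_1,y_1},\ \gamma_2\in\mathcal A^l_{x_2,y_2}),$$ $$\gamma^*_{\mathcal A}=\Psi^{\bar w}_{y,x}\big((R_w^*\otimes 1_x\otimes 1_{\bar w})(1_{\bar w}\otimes\gamma^*\otimes 1_{\bar w})(1_{\bar w}\otimes 1_y\otimes\bar R_w)\big)\qquad(\gamma\in\mathcal A^w_{x,y}),$$ where on the right-hand side $\gamma^*$ is the adjoint of the morphism $\gamma$. The corner $\mathcal A_{\mathbb 1,\mathbb 1}$ is identified with the fusion algebra $\mathbb C[\mathcal C]$. The tube cone of $\mathcal C$ is the subset $$\Sigma^2\mathcal C=\Big\{\sum_{i=1}^n a_ia_i^*\ :\ n\in\mathbb N,\ a_1,\dots,a_n\in\bigcup_{x\in\mathrm{Irr}}\mathcal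 A_{x,\mathbb 1}\Big\}$$ of $\mathcal A_{\mathbb 1,\mathbb 1}\subset\mathcal A$, with product and involution taken in $\mathcal A$. Then the tube cone is salient: $$\Sigma^2\mathcal C\cap(-\Sigma^2\mathcal C)=\{0\}.$$ -/

import Mathlib

open CategoryTheory MonoidalCategory
open scoped Pointwise

universe v u

namespace TubeCone

/-- A C*-tensor category, closed under finite direct sums and subobjects.  It is not assumed to be
strict: the associators and unitors are unitary.  Composition is written in diagrammatic order, so
that `f ≫ dag f` is the endomorphism usually denoted `f* f`. -/
class CStarTensorCategory (C : Type u) [Category.{v} C] [Preadditive C] [Linear ℂ C]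
    [MonoidalCategory C] [MonoidalPreadditive C] [MonoidalLinear ℂ C] where
  /-- the involution on morphisms -/
  dag {X Y : C} : (X ⟶ Y) → (Y ⟶ X)
  dag_dag {X Y : C} (f : X ⟶ Y) : dag (dag f) = f
  dag_comp {X Y Z : C} (f : X ⟶ Y) (g : Y ⟶ Z) : dag (f ≫ g) = dag g ≫ dag f
  dag_add {X Y : C} (f g : X ⟶ Y) : dag (f + g) = dag f + dag g
  dag_smul {X Y : C} (c : ℂ) (f : X ⟶ Y) : dag (c • f) = star c • dag f
  /-- the norm on the morphism spaces -/
  nrm {X Y : C} : (X ⟶ Y) → ℝ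
  nrm_add_le {X Y : C} (f g : X ⟶ Y) : nrm (f + g) ≤ nrm f + nrm g
  nrm_smul {X Y : C} (c : ℂ) (f : X ⟶ Y) : nrm (c • f) = ‖c‖ * nrm f
  eq_zero_of_nrm {X Y : C} (f : X ⟶ Y) : nrm f = 0 → f = 0
  nrm_complete {X Y : C} (f : ℕ → (X ⟶ Y)) :
    (∀ ε > 0, ∃ N, ∀ m ≥ N, ∀ n ≥ N, nrm (f m - f n) < ε) →
      ∃ g : X ⟶ Y, ∀ ε > 0, ∃ N, ∀ n ≥ N, nrm (f n - g) < ε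
  nrm_comp_le {X Y Z : C} (f : X ⟶ Y) (g : Y ⟶ Z) : nrm (f ≫ g) ≤ nrm f * nrm g
  nrm_comp_dag {X Y : C} (f : X ⟶ Y) : nrm (f ≫ dag f) = nrm f ^ 2
  /-- `f* f` is a positive element of the C*-algebra of endomorphisms of the source -/
  pos {X Y : C} (f : X ⟶ Y) : ∃ g : X ⟶ X, f ≫ dag f = g ≫ dag g
  dag_tensor {X Y Z W : C} (f : X ⟶ Y) (g : Z ⟶ W) : dag (f ⊗ₘ g) = dag f ⊗ₘ dag g
  dag_associator (X Y Z : C) : dag (α_ X Y Z).hom = (α_ X Y Z).inv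
  dag_leftUnitor (X : C) : dag (λ_ X).hom = (λ_ X).inv
  dag_rightUnitor (X : C) : dag (ρ_ X).hom = (ρ_ X).inv
  exists_directSum (X Y : C) : ∃ (Z : C) (i : X ⟶ Z) (j : Y ⟶ Z),
    i ≫ dag i = 𝟙 X ∧ j ≫ dag j = 𝟙 Y ∧ dag i ≫ i + dag j ≫ j = 𝟙 Z
  exists_subobject {X : C} (p : X ⟶ X) : dag p = p → p ≫ p = p →
    ∃ (Y : C) (i : Y ⟶ X), i ≫ dag i = 𝟙 Y ∧ dag i ≫ i = p

section

open CStarTensorCategory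

variable {C : Type u} [Category.{v} C] [Preadditive C] [Linear ℂ C]
  [MonoidalCategory C] [MonoidalPreadditive C] [MonoidalLinear ℂ C]

/-- An object is simple when it is nonzero and its endomorphisms are the scalars. -/
def IsSimple (X : C) : Prop :=
  𝟙 X ≠ 0 ∧ ∀ f : X ⟶ X, ∃ c : ℂ, f = c • 𝟙 X

variable [CStarTensorCategory C]

/-- The conjugate equations for a pair `(X, Y)`, where `R : 𝟙 ⟶ Y ⊗ X` and `Rb : 𝟙 ⟶ X ⊗ Y`:
`(1_Y ⊗ Rb*) (R ⊗ 1_Y) = 1_Y` and `(1_X ⊗ R*) (Rb ⊗ 1_X) = 1_X`. -/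
def ConjugateEquations {X Y : C} (R : 𝟙_ C ⟶ Y ⊗ X) (Rb : 𝟙_ C ⟶ X ⊗ Y) : Prop :=
  (λ_ Y).inv ≫ R ▷ Y ≫ (α_ Y X Y).hom ≫ Y ◁ dag Rb ≫ (ρ_ Y).hom = 𝟙 Y ∧
  (λ_ X).inv ≫ Rb ▷ X ≫ (α_ X Y X).hom ≫ X ◁ dag R ≫ (ρ_ X).hom = 𝟙 X

variable (C) in
/-- A rigid C*-tensor category with simple tensor unit. -/
class IsRigidWithSimpleUnit : Prop where
  exists_conjugate (X : C) :
    ∃ (Y : C) (R : 𝟙_ C ⟶ Y ⊗ X) (Rb : 𝟙_ C ⟶ X ⊗ Y), ConjugateEquations R Rb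
  simple_unit : IsSimple (𝟙_ C)

/-- A conjugate of `X` with a standard solution to the conjugate equations. -/
structure StandardSolution (X : C) where
  conj : C
  R : 𝟙_ C ⟶ conj ⊗ X
  Rb : 𝟙_ C ⟶ X ⊗ conj
  conjugateEquations : ConjugateEquations R Rb
  standard (f : X ⟶ X) : R ≫ conj ◁ f ≫ dag R = Rb ≫ f ▷ conj ≫ dag Rb

variable (C) in
/-- A set of representatives of the isomorphism classes of simple objects (containing the tensor
unit), together with a fixed standard solution for each of them. -/
structure Irr where
  carrier : Set C
  simple : ∀ w ∈ carrier, IsSimple w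
  eq_of_iso : ∀ w ∈ carrier, ∀ w' ∈ carrier, Nonempty (w ≅ w') → w = w'
  exists_iso : ∀ X : C, IsSimple X → ∃ w ∈ carrier, Nonempty (X ≅ w)
  unit_mem : 𝟙_ C ∈ carrier
  sol (w : carrier) : StandardSolution (w : C)

/-- Orthonormality in `C(w, z)` for the inner product given by `τ* σ = ⟨σ, τ⟩ 1_w`. -/
def IsOrthonormal {w z : C} {n : ℕ} (V : Fin n → (w ⟶ z)) : Prop :=
  ∀ i j, V i ≫ dag (V j) = if i = j then 𝟙 w else 0

/-! ### Facts that make the sums below meaningful -/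

lemma dag_zero {X Y : C} : dag (0 : X ⟶ Y) = 0 := by
  simpa using dag_smul (0 : ℂ) (0 : X ⟶ Y)

lemma dag_neg {X Y : C} (f : X ⟶ Y) : dag (-f) = -dag f := by
  simpa using dag_smul (-1 : ℂ) f

lemma dag_sub {X Y : C} (f g : X ⟶ Y) : dag (f - g) = dag f - dag g := by
  rw [sub_eq_add_neg, dag_add, dag_neg, sub_eq_add_neg]

lemma dag_sum {X Y : C} {ι : Type*} (s : Finset ι) (f : ι → (X ⟶ Y)) :
    dag (∑ i ∈ s, f i) = ∑ i ∈ s, dag (f i) := by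
  classical
  induction s using Finset.induction_on with
  | empty => simp [dag_zero]
  | insert a s ha ih => rw [Finset.sum_insert ha, Finset.sum_insert ha, dag_add, ih]

lemma dag_id (X : C) : dag (𝟙 X) = 𝟙 X := by
  have h := dag_comp (dag (𝟙 X)) (𝟙 X)
  rw [Category.comp_id, dag_dag, Category.comp_id] at h
  exact h.symm

lemma dag_whiskerLeft (X : C) {Y Z : C} (f : Y ⟶ Z) : dag (X ◁ f) = X ◁ dag f := by
  rw [← id_tensorHom, dag_tensor, dag_id, id_tensorHom]

lemma dag_whiskerRight {Y Z : C} (f : Y ⟶ Z) (X : C) : dag (f ▷ X) = dag f ▷ X := by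
  rw [← tensorHom_id, dag_tensor, dag_id, tensorHom_id]

lemma eq_zero_of_comp_dag {X Y : C} {f : X ⟶ Y} (h : f ≫ dag f = 0) : f = 0 := by
  apply eq_zero_of_nrm
  have h0 : nrm (0 : X ⟶ X) = 0 := by simpa using nrm_smul (0 : ℂ) (0 : X ⟶ X)
  have := nrm_comp_dag f
  rw [h, h0] at this
  exact pow_eq_zero_iff (two_ne_zero) |>.1 this.symm

set_option linter.unusedSectionVars false in
lemma IsSimple.smul_inj {X : C} (hX : IsSimple X) {c d : ℂ} (h : c • 𝟙 X = d • 𝟙 X) : c = d := by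
  have : (c - d) • 𝟙 X = 0 := by rw [sub_smul, h, sub_self]
  exact sub_eq_zero.1 ((smul_eq_zero.1 this).resolve_right hX.1)

lemma IsSimple.comp_dag {X Y : C} (hX : IsSimple X) (f : X ⟶ Y) :
    ∃ c : ℝ, 0 ≤ c ∧ f ≫ dag f = (c : ℂ) • 𝟙 X := by
  obtain ⟨g, hg⟩ := pos f
  obtain ⟨c, rfl⟩ := hX.2 g
  refine ⟨Complex.normSq c, Complex.normSq_nonneg c, ?_⟩
  rw [hg, dag_smul, dag_id]
  simp [smul_smul, Complex.normSq_eq_conj_mul_self]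

lemma IsSimple.comp_dag_pos {X Y : C} (hX : IsSimple X) {f : X ⟶ Y} (hf : f ≠ 0) :
    ∃ c : ℝ, 0 < c ∧ f ≫ dag f = (c : ℂ) • 𝟙 X := by
  obtain ⟨c, hc, h⟩ := hX.comp_dag f
  refine ⟨c, lt_of_le_of_ne hc ?_, h⟩
  rintro rfl
  exact hf (eq_zero_of_comp_dag (by simpa using h))

lemma IsSimple.exists_isometry {X Y : C} (hX : IsSimple X) {f : X ⟶ Y} (hf : f ≠ 0) :
    ∃ c : ℂ, c ≠ 0 ∧ (c • f) ≫ dag (c • f) = 𝟙 X := by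
  obtain ⟨c, hc, h⟩ := hX.comp_dag_pos hf
  refine ⟨((√c)⁻¹ : ℝ), by simpa using (Real.sqrt_pos.2 hc).ne', ?_⟩
  rw [dag_smul, Linear.smul_comp, Linear.comp_smul, h, smul_smul, smul_smul, mul_assoc]
  have : (((√c)⁻¹ : ℝ) : ℂ) * (star (((√c)⁻¹ : ℝ) : ℂ) * (c : ℂ)) = 1 := by
    rw [RCLike.star_def, Complex.conj_ofReal]
    norm_cast
    have := Real.mul_self_sqrt hc.le
    have h2 := (Real.sqrt_pos.2 hc).ne'
    field_simp
    nlinarith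
  rw [this, one_smul]

lemma IsSimple.nonempty_iso {X Y : C} (hX : IsSimple X) (hY : IsSimple Y) {f : X ⟶ Y}
    (hf : f ≠ 0) : Nonempty (X ≅ Y) := by
  obtain ⟨c, hc, h⟩ := hX.exists_isometry hf
  set g := c • f
  have hg : g ≠ 0 := fun h0 => hX.1 (by rw [← h, h0, Limits.zero_comp])
  obtain ⟨d, hd⟩ := hY.2 (dag g ≫ g)
  have h1 : g = d • g := by
    calc g = (g ≫ dag g) ≫ g := by rw [h, Category.id_comp]
      _ = d • g := by rw [Category.assoc, hd, Linear.comp_smul, Category.comp_id]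
  have h2 : d = 1 := by
    have : (1 - d) • g = 0 := by rw [sub_smul, ← h1, one_smul, sub_self]
    exact (sub_eq_zero.1 ((smul_eq_zero.1 this).resolve_right hg)).symm
  exact ⟨⟨g, dag g, h, by rw [hd, h2, one_smul]⟩⟩

section

variable [IsRigidWithSimpleUnit C]

lemma simple_unit : IsSimple (𝟙_ C) := IsRigidWithSimpleUnit.simple_unit

lemma exists_isometry_bound (z : C) : ∃ N : ℕ, ∀ n : ℕ, ∀ (w : Fin n → C) (V : ∀ i, w i ⟶ z),
    (∀ i, IsSimple (w i)) → (∀ i, V i ≫ dag (V i) = 𝟙 (w i)) →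
    (∀ i j, i ≠ j → V i ≫ dag (V j) = 0) → n ≤ N := by
  obtain ⟨Y, R, Rb, -, hR⟩ := IsRigidWithSimpleUnit.exists_conjugate z
  obtain ⟨d, hd0, hd⟩ := simple_unit.comp_dag R
  obtain ⟨e, he0, he⟩ := simple_unit.comp_dag Rb
  refine ⟨⌊e * d⌋₊, fun n w V hw hV hV' => ?_⟩
  have key : ∀ i, ∃ t : ℝ, R ≫ Y ◁ (dag (V i) ≫ V i) ≫ dag R = (t : ℂ) • 𝟙 (𝟙_ C) ∧
      1 ≤ e * t := by
    intro i
    obtain ⟨t, ht0, ht⟩ := simple_unit.comp_dag (R ≫ Y ◁ dag (V i))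
    have ht' := ht
    rw [dag_comp, dag_whiskerLeft, dag_dag] at ht'
    refine ⟨t, by rw [← ht', whiskerLeft_comp]; simp only [Category.assoc], ?_⟩
    set r : Y ⊗ w i ⟶ 𝟙_ C := Y ◁ V i ≫ dag R with hr
    have hrd : dag r = R ≫ Y ◁ dag (V i) := by rw [hr, dag_comp, dag_dag, dag_whiskerLeft]
    set A : w i ⟶ z ⊗ (Y ⊗ w i) := (λ_ (w i)).inv ≫ Rb ▷ w i ≫ (α_ z Y (w i)).hom with hA
    have hVA : V i = A ≫ z ◁ r ≫ (ρ_ z).hom := by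
      calc V i = V i ≫ 𝟙 z := (Category.comp_id _).symm
        _ = A ≫ z ◁ r ≫ (ρ_ z).hom := by
          rw [← hR, hA, hr, whiskerLeft_comp]
          simp only [Category.assoc]
          rw [leftUnitor_inv_naturality_assoc, whisker_exchange_assoc, tensor_whiskerLeft]
          simp only [Category.assoc, Iso.inv_hom_id_assoc]
    have hAA : A ≫ dag A = (e : ℂ) • 𝟙 (w i) := by
      have h1 : dag (λ_ (w i)).inv = (λ_ (w i)).hom := by rw [← dag_leftUnitor, dag_dag]
      rw [hA, dag_comp, dag_comp, dag_associator, dag_whiskerRight, h1]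
      simp only [Category.assoc, Iso.hom_inv_id_assoc]
      rw [← comp_whiskerRight_assoc, he]
      simp only [MonoidalLinear.smul_whiskerRight, Linear.smul_comp, Linear.comp_smul,
        id_whiskerRight, Category.id_comp, Iso.inv_hom_id]
    set P : z ⊗ (Y ⊗ w i) ⟶ z ⊗ (Y ⊗ w i) := z ◁ (r ≫ dag r) with hP
    have hPd : dag P = P := by rw [hP, dag_whiskerLeft, dag_comp, dag_dag]
    have hPP : P ≫ P = (t : ℂ) • P := by
      rw [hP, ← whiskerLeft_comp]
      have : (r ≫ dag r) ≫ (r ≫ dag r) = (t : ℂ) • (r ≫ dag r) := by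
        have h2 : dag r ≫ r = (t : ℂ) • 𝟙 (𝟙_ C) := by rw [hrd, ← ht']
        calc (r ≫ dag r) ≫ (r ≫ dag r) = r ≫ (dag r ≫ r) ≫ dag r := by
              simp only [Category.assoc]
          _ = _ := by rw [h2, Linear.smul_comp, Linear.comp_smul, Category.id_comp]
      rw [this, MonoidalLinear.whiskerLeft_smul]
    have hAPA : A ≫ P ≫ dag A = 𝟙 (w i) := by
      rw [← hV i]
      conv_rhs => rw [hVA]
      rw [dag_comp A, dag_comp _ (ρ_ z).hom, dag_rightUnitor, dag_whiskerLeft, hP, whiskerLeft_comp]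
      simp only [Category.assoc, Iso.hom_inv_id_assoc]
    obtain ⟨c, hc0, hc⟩ := (hw i).comp_dag ((t : ℂ) • A - A ≫ P)
    have hcalc : ((t : ℂ) • A - A ≫ P) ≫ dag ((t : ℂ) • A - A ≫ P)
        = ((t ^ 2 * e - t : ℝ) : ℂ) • 𝟙 (w i) := by
      have e1 : A ≫ P ≫ P ≫ dag A = (t : ℂ) • 𝟙 (w i) := by
        rw [← Category.assoc P P, hPP]
        rw [Linear.smul_comp, Linear.comp_smul, hAPA]
      rw [dag_sub, dag_smul, dag_comp A P, hPd]
      simp only [Preadditive.sub_comp, Preadditive.comp_sub, Linear.smul_comp, Linear.comp_smul,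
        Category.assoc, hAA, hAPA, e1, smul_smul, RCLike.star_def, Complex.conj_ofReal]
      push_cast
      module
    rw [hcalc] at hc
    have h3 : t ^ 2 * e - t = c := by exact_mod_cast (hw i).smul_inj hc
    have ht1 : 0 < t := by
      refine lt_of_le_of_ne ht0 ?_
      rintro rfl
      have h4 : dag r = 0 := by
        rw [hrd]; exact eq_zero_of_comp_dag (by simpa using ht)
      have h5 : P = 0 := by rw [hP, h4]; simp
      apply (hw i).1
      rw [← hAPA, h5]; simp
    have : 0 ≤ t * (e * t - 1) := by nlinarith
    nlinarith [nonneg_of_mul_nonneg_right this ht1]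
  choose t ht ht1 using key
  set Q : z ⟶ z := ∑ i, dag (V i) ≫ V i with hQ
  have hQd : dag Q = Q := by
    rw [hQ, dag_sum]
    simp [dag_comp, dag_dag]
  have hQQ : Q ≫ Q = Q := by
    rw [hQ, Preadditive.sum_comp]
    refine Finset.sum_congr rfl fun i _ => ?_
    rw [Preadditive.comp_sum, Finset.sum_eq_single i]
    · rw [Category.assoc, ← Category.assoc (V i), hV, Category.id_comp]
    · intro j _ hj
      rw [Category.assoc, ← Category.assoc (V i), hV' i j hj.symm]
      simp
    · simp
  obtain ⟨c, hc0, hc⟩ := simple_unit.comp_dag (R ≫ Y ◁ (𝟙 z - Q))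
  have hcalc : (R ≫ Y ◁ (𝟙 z - Q)) ≫ dag (R ≫ Y ◁ (𝟙 z - Q))
      = ((d - ∑ i, t i : ℝ) : ℂ) • 𝟙 (𝟙_ C) := by
    rw [dag_comp, dag_whiskerLeft, dag_sub, dag_id, hQd, Category.assoc,
      ← whiskerLeft_comp_assoc]
    have : (𝟙 z - Q) ≫ (𝟙 z - Q) = 𝟙 z - Q := by
      simp [Preadditive.sub_comp, Preadditive.comp_sub, hQQ]
    rw [this, hQ, show Y ◁ (𝟙 z - ∑ i, dag (V i) ≫ V i) = Y ◁ 𝟙 z - Y ◁ ∑ i, dag (V i) ≫ V i from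
      map_sub ((tensoringLeft C).obj Y).mapAddHom _ _, whiskerLeft_sum]
    simp only [Preadditive.sub_comp, Preadditive.comp_sub, Preadditive.sum_comp,
      Preadditive.comp_sum, ht, whiskerLeft_id, Category.id_comp, hd]
    push_cast
    rw [sub_smul, Finset.sum_smul]
  rw [hcalc] at hc
  have h3 : d - ∑ i, t i = c := by exact_mod_cast simple_unit.smul_inj hc
  have h4 : (n : ℝ) ≤ ∑ i, e * t i := by
    calc (n : ℝ) = ∑ _i : Fin n, (1 : ℝ) := by simp
      _ ≤ _ := Finset.sum_le_sum fun i _ => ht1 i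
  rw [← Finset.mul_sum] at h4
  apply Nat.le_floor
  nlinarith

lemma exists_onb {w : C} (hw : IsSimple w) (z : C) :
    ∃ (n : ℕ) (V : Fin n → (w ⟶ z)), IsOrthonormal V ∧ Submodule.span ℂ (Set.range V) = ⊤ := by
  classical
  obtain ⟨N, hN⟩ := exists_isometry_bound z
  let P : ℕ → Prop := fun n => ∃ V : Fin n → (w ⟶ z), IsOrthonormal V
  have hP0 : P 0 := ⟨Fin.elim0, fun i => i.elim0⟩
  have hPN : ∀ n, P n → n ≤ N := by
    rintro n ⟨V, hV⟩
    exact hN n (fun _ => w) V (fun _ => hw) (fun i => by simpa using hV i i)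
      (fun i j hij => by simpa [hij] using hV i j)
  obtain ⟨V, hV⟩ : P (Nat.findGreatest P N) := Nat.findGreatest_spec (Nat.zero_le _) hP0
  refine ⟨_, V, hV, ?_⟩
  by_contra hne
  obtain ⟨f, hf⟩ : ∃ f, f ∉ Submodule.span ℂ (Set.range V) := by
    by_contra! h
    exact hne (eq_top_iff.2 fun x _ => h x)
  choose c hc using fun i => hw.2 (f ≫ dag (V i))
  set g := f - ∑ i, c i • V i with hg
  have hmem : ∑ i, c i • V i ∈ Submodule.span ℂ (Set.range V) :=
    Submodule.sum_mem _ fun i _ => Submodule.smul_mem _ _ (Submodule.subset_span ⟨i, rfl⟩)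
  have hg0 : g ≠ 0 := fun h => hf (by rw [sub_eq_zero.1 h]; exact hmem)
  have hgV : ∀ j, g ≫ dag (V j) = 0 := by
    intro j
    rw [hg, Preadditive.sub_comp, Preadditive.sum_comp, hc]
    simp [hV _ j]
  obtain ⟨s, hs, hsg⟩ := hw.exists_isometry hg0
  have hsV : ∀ j, (s • g) ≫ dag (V j) = 0 := fun j => by rw [Linear.smul_comp, hgV, smul_zero]
  have hVs : ∀ j, V j ≫ dag (s • g) = 0 := fun j => by
    rw [← dag_dag (V j ≫ dag (s • g)), dag_comp, dag_dag, hsV, dag_zero]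
  have hP1 : P (Nat.findGreatest P N + 1) := by
    refine ⟨Fin.cons (s • g) V, fun i j => ?_⟩
    refine Fin.cases ?_ (fun i => ?_) i <;> refine Fin.cases ?_ (fun j => ?_) j
    · simpa using hsg
    · simpa [(Fin.succ_ne_zero j).symm] using hsV j
    · simpa [Fin.succ_ne_zero i] using hVs i
    · simpa using hV i j
  have := Nat.le_findGreatest (hPN _ hP1) hP1
  omega

lemma finite_constituents (I : Irr C) (z : C) :
    {w : I.carrier | ∃ f : (w : C) ⟶ z, f ≠ 0}.Finite := by
  obtain ⟨N, hN⟩ := exists_isometry_bound z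
  by_contra hinf
  obtain ⟨s, hs, hcard⟩ := Set.Infinite.exists_subset_card_eq hinf (N + 1)
  have hV : ∀ w : s, ∃ V : (w.1.1 : C) ⟶ z, V ≫ dag V = 𝟙 _ := by
    intro w
    obtain ⟨f, hf⟩ := hs w.2
    obtain ⟨c, -, h⟩ := (I.simple _ w.1.2).exists_isometry hf
    exact ⟨_, h⟩
  choose V hV using hV
  let e : Fin (N + 1) ≃ s := (s.equivFinOfCardEq hcard).symm
  have := hN (N + 1) (fun i => ((e i).1 : C)) (fun i => V (e i)) (fun i => I.simple _ (e i).1.2)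
    (fun i => hV (e i)) (fun i j hij => by
      by_contra h
      have := I.eq_of_iso _ (e i).1.2 _ (e j).1.2
        ((I.simple _ (e i).1.2).nonempty_iso (I.simple _ (e j).1.2) h)
      exact hij (e.injective (Subtype.ext (Subtype.ext this))))
  omega

lemma nonempty_standardSolution {w : C} (hw : IsSimple w) : Nonempty (StandardSolution w) := by
  obtain ⟨Y, R, Rb, h1, h2⟩ := IsRigidWithSimpleUnit.exists_conjugate w
  have hR0 : R ≠ 0 := by
    rintro rfl
    apply hw.1
    rw [← h2, dag_zero]
    simp
  have hRb0 : Rb ≠ 0 := by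
    rintro rfl
    apply hw.1
    rw [← h2]
    simp
  obtain ⟨d, hd0, hd⟩ := simple_unit.comp_dag_pos hR0
  obtain ⟨e, he0, he⟩ := simple_unit.comp_dag_pos hRb0
  set s : ℝ := √(√(e / d)) with hs
  have hs0 : 0 < s := by positivity
  have hs4 : s ^ 2 * s ^ 2 * d = e := by
    rw [hs, Real.sq_sqrt (by positivity), ← sq, Real.sq_sqrt (by positivity)]
    field_simp
  have hsc : (s : ℂ) ≠ 0 := by exact_mod_cast hs0.ne'
  refine ⟨⟨Y, (s : ℂ) • R, ((s⁻¹ : ℝ) : ℂ) • Rb, ⟨?_, ?_⟩, ?_⟩⟩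
  · rw [dag_smul, RCLike.star_def, Complex.conj_ofReal]
    simp only [MonoidalLinear.smul_whiskerRight, MonoidalLinear.whiskerLeft_smul,
      Linear.smul_comp, Linear.comp_smul, smul_smul]
    rw [h1]
    simp [hsc]
  · rw [dag_smul, RCLike.star_def, Complex.conj_ofReal]
    simp only [MonoidalLinear.smul_whiskerRight, MonoidalLinear.whiskerLeft_smul,
      Linear.smul_comp, Linear.comp_smul, smul_smul]
    rw [h2]
    simp [hsc]
  · intro f
    obtain ⟨c, rfl⟩ := hw.2 f
    simp only [dag_smul, RCLike.star_def, Complex.conj_ofReal, MonoidalLinear.smul_whiskerRight,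
      MonoidalLinear.whiskerLeft_smul, Linear.smul_comp, Linear.comp_smul, smul_smul,
      whiskerLeft_id, id_whiskerRight, Category.id_comp, hd, he]
    congr 1
    rw [← hs4]
    push_cast
    field_simp

variable (C) in
lemma nonempty_irr : Nonempty (Irr C) := by
  classical
  let S : Setoid {X : C // IsSimple X} :=
    { r := fun X Y => Nonempty (X.1 ≅ Y.1)
      iseqv := ⟨fun X => ⟨Iso.refl _⟩, fun ⟨i⟩ => ⟨i.symm⟩, fun ⟨i⟩ ⟨j⟩ => ⟨i.trans j⟩⟩ }
  let u : {X : C // IsSimple X} := ⟨𝟙_ C, simple_unit⟩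
  let rep : Quotient S → {X : C // IsSimple X} := fun q => if q = ⟦u⟧ then u else q.out
  have hrep : ∀ q, ⟦rep q⟧ = q := by
    intro q
    by_cases h : q = ⟦u⟧
    · rw [h]
      simp [rep]
    · simp only [rep, if_neg h, Quotient.out_eq]
  refine ⟨⟨Set.range fun q => (rep q).1, ?_, ?_, ?_, ⟨⟦u⟧, by simp [rep, u]⟩, fun w =>
    (nonempty_standardSolution ?_).some⟩⟩
  · rintro _ ⟨q, rfl⟩
    exact (rep q).2
  · rintro _ ⟨q, rfl⟩ _ ⟨q', rfl⟩ h
    have : (⟦rep q⟧ : Quotient S) = ⟦rep q'⟧ := Quotient.sound h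
    rw [hrep, hrep] at this
    rw [this]
  · intro X hX
    exact ⟨_, ⟨⟦⟨X, hX⟩⟧, rfl⟩, Quotient.exact (hrep ⟦⟨X, hX⟩⟧).symm⟩
  · obtain ⟨_, q, rfl⟩ := w
    exact (rep q).2

end

/-! ### The tube algebra -/

namespace Irr

variable (I : Irr C)

/-- The tensor unit as an element of `Irr`. -/
def one : I.carrier := ⟨𝟙_ C, I.unit_mem⟩

/-- The corner `A_{x,y} = ⨁_w C(w ⊗ x, y ⊗ w)`, where `w` runs through `Irr`. -/
abbrev Corner (x y : C) : Type _ := Π₀ w : I.carrier, ((w : C) ⊗ x ⟶ y ⊗ (w : C))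

variable [IsRigidWithSimpleUnit C]

/-- The number of elements of an orthonormal basis of `C(w, z)`. -/
noncomputable def mult (w : I.carrier) (z : C) : ℕ := (exists_onb (I.simple w w.2) z).choose

/-- An orthonormal basis of `C(w, z)`. -/
noncomputable def onb (w : I.carrier) (z : C) : Fin (I.mult w z) → ((w : C) ⟶ z) :=
  (exists_onb (I.simple w w.2) z).choose_spec.choose

/-- The finitely many elements of `Irr` that occur in `z`. -/
noncomputable def constituents (z : C) : Finset I.carrier := (finite_constituents I z).toFinset

open Classical in
/-- The canonical map `Ψ^z_{x,y} : C(z ⊗ x, y ⊗ z) → A_{x,y}`, whose component at `w` is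
`∑_α (1_y ⊗ α*) γ (α ⊗ 1_x)`, over an orthonormal basis of `C(w, z)`. -/
noncomputable def Psi (z : C) {x y : C} (γ : z ⊗ x ⟶ y ⊗ z) : I.Corner x y :=
  ∑ w ∈ I.constituents z, DFinsupp.single w
    (∑ i, (I.onb w z i) ▷ x ≫ γ ≫ y ◁ dag (I.onb w z i))

end Irr

/-- `(γ₁ ⊗ 1) (1 ⊗ γ₂)`. -/
def tubeComp {m l i s j : C} (γ₁ : m ⊗ s ⟶ j ⊗ m) (γ₂ : l ⊗ i ⟶ s ⊗ l) :
    (m ⊗ l) ⊗ i ⟶ j ⊗ (m ⊗ l) :=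
  (α_ m l i).hom ≫ m ◁ γ₂ ≫ (α_ m s l).inv ≫ γ₁ ▷ l ≫ (α_ j m l).hom

/-- `(R* ⊗ 1_x ⊗ 1) (1 ⊗ γ* ⊗ 1) (1 ⊗ 1_y ⊗ Rb)`. -/
def tubeRot {w x y : C} (S : StandardSolution w) (γ : w ⊗ x ⟶ y ⊗ w) :
    S.conj ⊗ y ⟶ x ⊗ S.conj :=
  (ρ_ (S.conj ⊗ y)).inv ≫ (S.conj ⊗ y) ◁ S.Rb ≫ (α_ (S.conj ⊗ y) w S.conj).inv ≫
    (α_ S.conj y w).hom ▷ S.conj ≫ (S.conj ◁ dag γ) ▷ S.conj ≫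
    (α_ S.conj w x).inv ▷ S.conj ≫ (dag S.R ▷ x) ▷ S.conj ≫ (λ_ x).hom ▷ S.conj

namespace Irr

variable (I : Irr C) [IsRigidWithSimpleUnit C]

open Classical in
/-- The multiplication `A_{s,j} × A_{i,s} → A_{i,j}`, which is
`Ψ^{m ⊗ l}((γ₁ ⊗ 1) (1 ⊗ γ₂))` on `γ₁ ∈ A^m_{s,j}` and `γ₂ ∈ A^l_{i,s}`. -/
noncomputable def cornerMul {i s j : C} (a : I.Corner s j) (b : I.Corner i s) : I.Corner i j :=
  DFinsupp.sum a fun m γ₁ => DFinsupp.sum b fun l γ₂ =>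
    I.Psi ((m : C) ⊗ (l : C)) (tubeComp γ₁ γ₂)

open Classical in
/-- The involution `A_{x,y} → A_{y,x}`. -/
noncomputable def cornerStar {x y : C} (a : I.Corner x y) : I.Corner y x :=
  DFinsupp.sum a fun w γ => I.Psi (I.sol w).conj (tubeRot (I.sol w) γ)

/-- The tube algebra `A = ⨁_{x,y} A_{x,y}`, where `x` and `y` run through `Irr`. -/
abbrev TubeAlgebra (I : Irr C) : Type _ :=
  Π₀ p : I.carrier × I.carrier, I.Corner (p.1 : C) (p.2 : C)

open Classical in
/-- The inclusion of `A_{x,y}` in the tube algebra. -/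
noncomputable def incl (x y : I.carrier) : I.Corner (x : C) (y : C) →ₗ[ℂ] I.TubeAlgebra :=
  DFinsupp.lsingle (M := fun p : I.carrier × I.carrier => I.Corner (p.1 : C) (p.2 : C)) (x, y)

open Classical in
/-- The product of `a ∈ A_{x₁,y₁}` and `b ∈ A_{x₂,y₂}` is zero unless `x₁ = y₂`, and then it lies
in `A_{x₂,y₁}`. -/
noncomputable instance : Mul I.TubeAlgebra where
  mul a b := DFinsupp.sum a fun p f => DFinsupp.sum b fun q g =>
    if h : q.2 = p.1 then I.incl q.1 p.2 (I.cornerMul f (h ▸ g)) else 0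

open Classical in
noncomputable instance : Star I.TubeAlgebra where
  star a := DFinsupp.sum a fun p f => I.incl p.2 p.1 (I.cornerStar f)

/-- The corner `A_{x,y}` as a subspace of the tube algebra. -/
noncomputable def corner (x y : I.carrier) : Submodule ℂ I.TubeAlgebra :=
  LinearMap.range (I.incl x y)

/-- The tube cone: all finite sums of elements `a a*`, where `a` lies in some `A_{x,𝟙}`. -/
def tubeCone : Set I.TubeAlgebra :=
  {t | ∃ (n : ℕ) (a : Fin n → I.TubeAlgebra),
    (∀ i, ∃ x : I.carrier, a i ∈ I.corner x I.one) ∧ t = ∑ i, a i * star (a i)}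

end Irr

end

end TubeCone

namespace TubeCone

open CStarTensorCategory ExactPairing

variable {C : Type u} [Category.{v} C] [Preadditive C] [Linear ℂ C]
  [MonoidalCategory C] [MonoidalPreadditive C] [MonoidalLinear ℂ C] [CStarTensorCategory C]

/-! The coefficient at `w = 𝟙` of the corner `A_{𝟙,𝟙}` is an additive functional on the tube algebra
that is positive and faithful on the cone. If `t` and `-t` both lie in the cone, its values there
are nonnegative and opposite, hence zero, and faithfulness gives `t = 0`.

Everything thus reduces to one product `a a*` with `a ∈ A_{x,𝟙}`. Its unit coefficient is a sum over
pairs `m`, `v` in the support of `a`: the diagram of `a_m` and the rotated `a_v*` is closed up by a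
morphism `U : 𝟙 ⟶ m ⊗ v̄` and its adjoint. By Frobenius reciprocity `U` is `Rb` of `v` followed by a
morphism `v ⟶ m`, so by Schur's lemma only `m = v` contributes, with `U` a multiple of `Rb`. A
zigzag then brings the closed diagram to the form `f* f` (`Rb_comp_tubeComp_tubeRot`), a nonnegative
scalar that vanishes only when `a_v = 0` (`exists_nonneg_tubeComp_tubeRot`). Faithfulness also needs
some nonzero `U` to occur for each `v` (`exists_onb_comp_onb_ne_zero`). -/

lemma dag_leftUnitor_inv (X : C) : dag (λ_ X).inv = (λ_ X).hom := by
  rw [← dag_leftUnitor, dag_dag]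

/-! ### Frobenius reciprocity and positivity for one standard solution -/

namespace StandardSolution

/-- A solution of the conjugate equations is a duality. -/
@[reducible]
def exactPairing {w : C} (S : StandardSolution w) : ExactPairing w S.conj where
  coevaluation' := S.Rb
  evaluation' := dag S.R
  coevaluation_evaluation' := by
    -- The first conjugate equation involves `R` and `Rb*`; its adjoint involves `R*` and `Rb`, the
    -- chosen evaluation and coevaluation.
    have h := congrArg dag S.conjugateEquations.1
    simp only [dag_comp, dag_id, dag_whiskerLeft, dag_whiskerRight, dag_dag, dag_associator,
      dag_leftUnitor_inv, dag_rightUnitor, Category.assoc] at h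
    rw [← cancel_epi (ρ_ S.conj).inv, ← cancel_mono (λ_ S.conj).hom]
    simpa using h
  evaluation_coevaluation' := by
    have h := S.conjugateEquations.2
    rw [← cancel_epi (λ_ w).inv, ← cancel_mono (ρ_ w).hom]
    simpa using h

/-- Frobenius reciprocity `C(w, z) ≅ C(𝟙, z ⊗ w̄)`, used for its surjectivity. -/
lemma exists_eq_Rb_comp {w z : C} (S : StandardSolution w) (U : 𝟙_ C ⟶ z ⊗ S.conj) :
    ∃ h : w ⟶ z, U = S.Rb ≫ h ▷ S.conj := by
  let _ := S.exactPairing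
  obtain ⟨g, rfl⟩ := (tensorRightHomEquiv (𝟙_ C) w S.conj z).surjective U
  refine ⟨(λ_ w).inv ≫ g, ?_⟩
  change (ρ_ _).inv ≫ _ ◁ S.Rb ≫ (α_ _ _ _).inv ≫ g ▷ _ = _
  monoidal

lemma Rb_comp_injective {w z : C} (S : StandardSolution w) {h h' : w ⟶ z}
    (e : S.Rb ≫ h ▷ S.conj = S.Rb ≫ h' ▷ S.conj) : h = h' := by
  let _ := S.exactPairing
  have key : ∀ k : w ⟶ z, tensorRightHomEquiv (𝟙_ C) w S.conj z ((λ_ w).hom ≫ k)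
      = S.Rb ≫ k ▷ S.conj := by
    intro k
    change (ρ_ _).inv ≫ _ ◁ S.Rb ≫ (α_ _ _ _).inv ≫ ((λ_ w).hom ≫ k) ▷ _ = _
    monoidal
  rw [← key, ← key] at e
  exact (cancel_epi _).1 ((tensorRightHomEquiv (𝟙_ C) w S.conj z).injective e)

lemma Rb_comp_whiskerLeft_injective {w z : C} (S : StandardSolution w) {f f' : S.conj ⟶ z}
    (e : S.Rb ≫ w ◁ f = S.Rb ≫ w ◁ f') : f = f' := by
  let _ := S.exactPairing
  have key : ∀ k : S.conj ⟶ z, tensorLeftHomEquiv (𝟙_ C) w S.conj z ((ρ_ _).hom ≫ k)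
      = S.Rb ≫ w ◁ k := by
    intro k
    change (λ_ _).inv ≫ S.Rb ▷ _ ≫ (α_ _ _ _).hom ≫ _ ◁ ((ρ_ _).hom ≫ k) = _
    monoidal
  rw [← key, ← key] at e
  exact (cancel_epi _).1 ((tensorLeftHomEquiv (𝟙_ C) w S.conj z).injective e)

/-- Bending an endomorphism of `w̄` around `Rb` turns it into an endomorphism of `w`, which is a
scalar. -/
lemma isSimple_conj {w : C} (hw : IsSimple w) (S : StandardSolution w) : IsSimple S.conj := by
  constructor
  · intro h
    apply hw.1
    apply S.Rb_comp_injective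
    have : S.Rb = 0 := by
      calc S.Rb = S.Rb ≫ w ◁ 𝟙 S.conj := by simp
        _ = 0 := by rw [h]; simp
    rw [this]; simp
  · intro f
    obtain ⟨h, hh⟩ := S.exists_eq_Rb_comp (S.Rb ≫ w ◁ f)
    obtain ⟨c, rfl⟩ := hw.2 h
    refine ⟨c, S.Rb_comp_whiskerLeft_injective ?_⟩
    rw [hh]
    simp [MonoidalLinear.smul_whiskerRight, MonoidalLinear.whiskerLeft_smul]

/-- The outer `Rb` and the `R*` inside the rotation form a zigzag; only the inner `Rb` and `γ*`
survive. -/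
lemma Rb_comp_tubeRot {w x : C} (S : StandardSolution w) (γ : w ⊗ x ⟶ 𝟙_ C ⊗ w) :
    S.Rb ▷ 𝟙_ C ≫ (α_ _ _ _).hom ≫ w ◁ tubeRot S γ =
      (ρ_ _).hom ≫ S.Rb ≫ ((λ_ w).inv ≫ dag γ) ▷ S.conj ≫ (α_ _ _ _).hom := by
  let _ := S.exactPairing
  have hz : S.Rb ▷ w ⊗≫ w ◁ dag S.R = ⊗𝟙.hom := evaluation_coevaluation'' w S.conj
  -- Absorbing the unitor into `δ : w ⟶ w ⊗ x` removes the unit strand, so that the interchange law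
  -- can be applied to `δ` directly.
  obtain ⟨δ, hδ⟩ : ∃ δ, δ = (λ_ w).inv ≫ dag γ := ⟨_, rfl⟩
  have hγ : dag γ = (λ_ w).hom ≫ δ := by rw [hδ]; simp
  rw [← hδ, tubeRot, hγ]
  -- The two copies of `Rb` are interchanged, the outer one is slid past `δ`, and there it meets
  -- `R*` and is straightened by `hz`.
  calc
    _ = 𝟙 _ ⊗≫ (S.Rb ▷ (𝟙_ C) ≫ (w ⊗ S.conj) ◁ S.Rb) ⊗≫ w ◁ S.conj ◁ δ ▷ S.conj ⊗≫
          w ◁ dag S.R ▷ x ▷ S.conj ⊗≫ 𝟙 _ := by monoidal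
    _ = 𝟙 _ ⊗≫ S.Rb ⊗≫ (S.Rb ▷ w ≫ (w ⊗ S.conj) ◁ δ) ▷ S.conj ⊗≫
          w ◁ dag S.R ▷ x ▷ S.conj ⊗≫ 𝟙 _ := by rw [← whisker_exchange]; monoidal
    _ = 𝟙 _ ⊗≫ S.Rb ⊗≫ δ ▷ S.conj ⊗≫ (S.Rb ▷ w ⊗≫ w ◁ dag S.R) ▷ x ▷ S.conj ⊗≫ 𝟙 _ := by
      rw [← whisker_exchange]; monoidal
    _ = _ := by rw [hz]; monoidal

/-- By the zigzag, the part of the diagram before `γ` is `Rb` followed by `γ*`. The rest, `γ`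
followed by `Rb*`, is its adjoint up to unitors. This is the source of all positivity below. -/
lemma Rb_comp_tubeComp_tubeRot {w x : C} (S : StandardSolution w) (γ : w ⊗ x ⟶ 𝟙_ C ⊗ w) :
    S.Rb ▷ 𝟙_ C ≫ tubeComp γ (tubeRot S γ) ≫ 𝟙_ C ◁ dag S.Rb =
      (ρ_ _).hom ≫ ((S.Rb ≫ dag (γ ≫ (λ_ w).hom) ▷ S.conj) ≫
        dag (S.Rb ≫ dag (γ ≫ (λ_ w).hom) ▷ S.conj)) ≫ (λ_ _).inv := by
  have h := S.Rb_comp_tubeRot γ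
  rw [tubeComp]
  simp only [dag_comp, dag_whiskerRight, dag_dag, dag_leftUnitor, dag_leftUnitor_inv,
    Category.assoc]
  simp only [← Category.assoc] at h ⊢
  rw [h]
  simp only [Category.assoc]
  monoidal

/-- Simplicity of the unit makes `f* f` a nonnegative scalar. If it vanishes, the C*-identity gives
`f = 0`, and unbending `Rb` gives `γ = 0`. -/
lemma exists_nonneg_tubeComp_tubeRot (hC : IsSimple (𝟙_ C)) {w x : C} (S : StandardSolution w)
    (γ : w ⊗ x ⟶ 𝟙_ C ⊗ w) :
    ∃ r : ℝ, 0 ≤ r ∧ (r = 0 → γ = 0) ∧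
      S.Rb ▷ 𝟙_ C ≫ tubeComp γ (tubeRot S γ) ≫ 𝟙_ C ◁ dag S.Rb = (r : ℂ) • 𝟙 _ := by
  rw [Rb_comp_tubeComp_tubeRot]
  obtain ⟨r, hr, h⟩ := hC.comp_dag (S.Rb ≫ dag (γ ≫ (λ_ w).hom) ▷ S.conj)
  refine ⟨r, hr, ?_, ?_⟩
  · rintro rfl
    have h0 : S.Rb ≫ dag (γ ≫ (λ_ w).hom) ▷ S.conj = 0 := eq_zero_of_comp_dag (by simpa using h)
    have h1 : dag (γ ≫ (λ_ w).hom) = 0 := S.Rb_comp_injective (by rw [h0]; simp)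
    have h2 : γ ≫ (λ_ w).hom = 0 := by rw [← dag_dag (γ ≫ (λ_ w).hom), h1, dag_zero]
    rw [← cancel_mono (λ_ w).hom, h2, Limits.zero_comp]
  · rw [h, Linear.smul_comp, Linear.comp_smul, Category.id_comp, ← unitors_equal, Iso.hom_inv_id]

end StandardSolution

/-! ### Naturality and additivity of the tube composition -/

set_option linter.unusedSectionVars false in
-- The involution is defined through `Psi`, which sandwiches the rotated morphism between basis
-- vectors; this moves those vectors out of the product.
lemma tubeComp_conj {m l l' i s j : C} (γ₁ : m ⊗ s ⟶ j ⊗ m) (γ₂ : l ⊗ i ⟶ s ⊗ l) (f : l' ⟶ l)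
    (g : l ⟶ l') :
    tubeComp γ₁ (f ▷ i ≫ γ₂ ≫ s ◁ g) = (m ◁ f) ▷ i ≫ tubeComp γ₁ γ₂ ≫ j ◁ m ◁ g := by
  rw [tubeComp, tubeComp]
  calc
    _ = 𝟙 _ ⊗≫ m ◁ f ▷ i ⊗≫ m ◁ γ₂ ⊗≫ ((m ⊗ s) ◁ g ≫ γ₁ ▷ l') ⊗≫ 𝟙 _ := by monoidal
    _ = _ := by rw [whisker_exchange]; monoidal

set_option linter.unusedSectionVars false in
lemma tubeComp_add {m l i s j : C} (γ₁ : m ⊗ s ⟶ j ⊗ m) (γ₂ γ₃ : l ⊗ i ⟶ s ⊗ l) :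
    tubeComp γ₁ (γ₂ + γ₃) = tubeComp γ₁ γ₂ + tubeComp γ₁ γ₃ := by
  simp [tubeComp, MonoidalPreadditive.whiskerLeft_add]

namespace Irr

variable (I : Irr C) [IsRigidWithSimpleUnit C]

/-! ### Orthonormal bases and the map `Psi` -/

lemma onb_isOrthonormal (w : I.carrier) (z : C) : IsOrthonormal (I.onb w z) :=
  (exists_onb (I.simple w w.2) z).choose_spec.choose_spec.1

lemma span_onb (w : I.carrier) (z : C) : Submodule.span ℂ (Set.range (I.onb w z)) = ⊤ :=
  (exists_onb (I.simple w w.2) z).choose_spec.choose_spec.2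

lemma exists_onb_ne_zero {w : I.carrier} {z : C} {f : (w : C) ⟶ z} (hf : f ≠ 0) :
    ∃ i, I.onb w z i ≠ 0 := by
  by_contra! h
  apply hf
  have h0 : Submodule.span ℂ (Set.range (I.onb w z)) = ⊥ := by
    rw [Submodule.span_eq_bot]
    rintro _ ⟨i, rfl⟩
    exact h i
  have : f ∈ Submodule.span ℂ (Set.range (I.onb w z)) := by rw [span_onb]; trivial
  rwa [h0] at this

lemma onb_ne_zero (w : I.carrier) (z : C) (i) : I.onb w z i ≠ 0 := by
  intro h
  apply (I.simple w w.2).1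
  simpa [h] using (I.onb_isOrthonormal w z i i).symm

lemma mem_constituents {w : I.carrier} {z : C} :
    w ∈ I.constituents z ↔ ∃ f : (w : C) ⟶ z, f ≠ 0 := by
  simp [constituents]

lemma isEmpty_of_notMem_constituents {w : I.carrier} {z : C} (h : w ∉ I.constituents z) :
    IsEmpty (Fin (I.mult w z)) :=
  ⟨fun i => h (I.mem_constituents.2 ⟨_, I.onb_ne_zero w z i⟩)⟩

/-- The formula holds at every `w`: outside the constituents of `z` the basis is empty. -/
lemma Psi_apply (z : C) {x y : C} (γ : z ⊗ x ⟶ y ⊗ z) (w : I.carrier) :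
    I.Psi z γ w = ∑ i, I.onb w z i ▷ x ≫ γ ≫ y ◁ dag (I.onb w z i) := by
  classical
  rw [Psi, DFinsupp.finsetSum_apply]
  by_cases h : w ∈ I.constituents z
  · rw [Finset.sum_eq_single w]
    · convert DFinsupp.single_eq_same
    · intro b _ hb
      convert DFinsupp.single_eq_of_ne hb.symm
    · exact fun h' => (h' h).elim
  · have := I.isEmpty_of_notMem_constituents h
    rw [Finset.univ_eq_empty, Finset.sum_empty]
    refine Finset.sum_eq_zero fun b hb => ?_
    convert DFinsupp.single_eq_of_ne (fun e : w = b => h (e ▸ hb))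

lemma Psi_add (z : C) {x y : C} (γ γ' : z ⊗ x ⟶ y ⊗ z) :
    I.Psi z (γ + γ') = I.Psi z γ + I.Psi z γ' := by
  ext w
  simp [Psi_apply, Finset.sum_add_distrib]

/-! ### The unit component of `a a*` in a corner -/

/-- `Ψ^{m ⊗ l}((γ₁ ⊗ 1) (1 ⊗ γ₂))` as an additive function of `γ₂`. -/
noncomputable def mulRight {m l i s j : C} (γ₁ : m ⊗ s ⟶ j ⊗ m) :
    (l ⊗ i ⟶ s ⊗ l) →+ I.Corner i j :=
  AddMonoidHom.mk' (fun γ₂ => I.Psi (m ⊗ l) (tubeComp γ₁ γ₂)) fun γ₂ γ₃ => by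
    rw [tubeComp_add, Psi_add]

/-- Bending `U` gives `h : v ⟶ m`. Schur's lemma makes `h` zero for `m ≠ v` and a scalar `c` for `m
= v`, where `|c|²` multiplies the value at `Rb`. The whole of `a` is kept as the argument, so that
substituting `m = v` identifies the two components. -/
lemma exists_nonneg_comp_tubeComp_tubeRot {m : I.carrier} {x : C} {v : I.carrier}
    (U : 𝟙_ C ⟶ (m : C) ⊗ (I.sol v).conj)
    (a : I.Corner x (𝟙_ C)) :
    ∃ r : ℝ, 0 ≤ r ∧ (m = v → U ≠ 0 → r = 0 → a v = 0) ∧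
      U ▷ 𝟙_ C ≫ tubeComp (a m) (tubeRot (I.sol v) (a v)) ≫ 𝟙_ C ◁ dag U = (r : ℂ) • 𝟙 _ := by
  obtain ⟨h, rfl⟩ := (I.sol v).exists_eq_Rb_comp U
  by_cases hmv : m = v
  · subst hmv
    obtain ⟨c, rfl⟩ := (I.simple m m.2).2 h
    obtain ⟨r, hr, hr0, e⟩ := (I.sol m).exists_nonneg_tubeComp_tubeRot simple_unit (a m)
    refine ⟨Complex.normSq c * r, mul_nonneg (Complex.normSq_nonneg c) hr, fun _ hU h0 => ?_, ?_⟩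
    · rcases mul_eq_zero.1 h0 with h0 | h0
      · rw [Complex.normSq_eq_zero] at h0
        exact (hU (by simp [h0])).elim
      · exact hr0 h0
    · have hU : (I.sol m).Rb ≫ (c • 𝟙 (m : C)) ▷ (I.sol m).conj = c • (I.sol m).Rb := by
        simp [MonoidalLinear.smul_whiskerRight]
      rw [hU, dag_smul]
      simp only [MonoidalLinear.smul_whiskerRight, MonoidalLinear.whiskerLeft_smul,
        Linear.smul_comp, Linear.comp_smul, e, smul_smul]
      push_cast
      rw [Complex.normSq_eq_conj_mul_self, RCLike.star_def]
      congr 1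
      ring
  · have h0 : h = 0 := by
      by_contra hne
      exact hmv (Subtype.ext (I.eq_of_iso _ v.2 _ m.2
        ((I.simple v v.2).nonempty_iso (I.simple m m.2) hne))).symm
    exact ⟨0, le_rfl, fun e => (hmv e).elim, by simp [h0]⟩

open Classical in
-- In this form additivity in the second factor is available to `map_sum`, which is what expands the
-- product when `b = a*`.
lemma cornerMul_eq {i s j : C} (a : I.Corner s j) (b : I.Corner i s) :
    I.cornerMul a b = ∑ m ∈ a.support, DFinsupp.sumAddHom (fun l : I.carrier =>
      (I.mulRight (a m) : ((l : C) ⊗ i ⟶ s ⊗ (l : C)) →+ I.Corner i j)) b := by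
  simp only [DFinsupp.sumAddHom_apply]
  rfl

open Classical in
lemma cornerMul_cornerStar {x y : C} (a : I.Corner x y) :
    I.cornerMul a (I.cornerStar a) = ∑ m ∈ a.support, ∑ v ∈ a.support,
      ∑ l ∈ I.constituents (I.sol v).conj, ∑ i, I.Psi ((m : C) ⊗ (l : C))
        (tubeComp (a m) ((I.onb l (I.sol v).conj i) ▷ y ≫ tubeRot (I.sol v) (a v) ≫
          x ◁ dag (I.onb l (I.sol v).conj i))) := by
  rw [cornerMul_eq]
  refine Finset.sum_congr rfl fun m _ => ?_
  rw [cornerStar, DFinsupp.sum, map_sum]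
  refine Finset.sum_congr rfl fun v _ => ?_
  rw [Psi, map_sum]
  refine Finset.sum_congr rfl fun l _ => ?_
  rw [DFinsupp.sumAddHom_single, map_sum]
  rfl

open Classical in
-- The basis vectors `w ⟶ m ⊗ l` and `l ⟶ v̄` merge into one morphism `w ⟶ m ⊗ v̄`; at `w = 𝟙` it
-- plays the role of `U`.
lemma cornerMul_cornerStar_apply {x y : C} (a : I.Corner x y) (w : I.carrier) :
    I.cornerMul a (I.cornerStar a) w = ∑ m ∈ a.support, ∑ v ∈ a.support,
      ∑ l ∈ I.constituents (I.sol v).conj, ∑ i, ∑ k,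
        (I.onb w ((m : C) ⊗ (l : C)) k ≫ (m : C) ◁ I.onb l (I.sol v).conj i) ▷ y ≫
          tubeComp (a m) (tubeRot (I.sol v) (a v)) ≫
          y ◁ dag (I.onb w ((m : C) ⊗ (l : C)) k ≫ (m : C) ◁ I.onb l (I.sol v).conj i) := by
  rw [cornerMul_cornerStar]
  simp only [DFinsupp.finsetSum_apply, Psi_apply, tubeComp_conj, dag_comp, dag_whiskerLeft,
    comp_whiskerRight, whiskerLeft_comp, Category.assoc]

/-- Needed for faithfulness. Since `v̄` is simple, it has a representative `l`, and `Rb` followed by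
`v̄ ≅ l` is a nonzero morphism `𝟙 ⟶ v ⊗ l`, so both bases are nonempty. -/
lemma exists_onb_comp_onb_ne_zero (v : I.carrier) :
    ∃ l ∈ I.constituents (I.sol v).conj, ∃ i k,
      I.onb I.one ((v : C) ⊗ (l : C)) k ≫ (v : C) ◁ I.onb l (I.sol v).conj i ≠ 0 := by
  have hs := (I.sol v).isSimple_conj (I.simple v v.2)
  obtain ⟨l, hl, ⟨e⟩⟩ := I.exists_iso _ hs
  have he : e.inv ≠ 0 := fun h => hs.1 (by rw [← e.hom_inv_id, h, Limits.comp_zero])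
  obtain ⟨i, -⟩ := I.exists_onb_ne_zero (w := ⟨l, hl⟩) he
  have hR : (I.sol v).Rb ≫ (v : C) ◁ e.hom ≠ 0 := by
    intro h
    have h' : e.hom = 0 := (I.sol v).Rb_comp_whiskerLeft_injective (by rw [h]; simp)
    exact hs.1 (by rw [← e.hom_inv_id, h', Limits.zero_comp])
  obtain ⟨k, hk⟩ := I.exists_onb_ne_zero (w := I.one) hR
  refine ⟨⟨l, hl⟩, I.mem_constituents.2 ⟨_, he⟩, i, k, fun h => hk ?_⟩
  have hi := I.onb_isOrthonormal ⟨l, hl⟩ (I.sol v).conj i i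
  rw [if_pos rfl] at hi
  -- The second basis vector is an isometry, so composing with its adjoint recovers the first.
  calc I.onb I.one ((v : C) ⊗ l) k
      = (I.onb I.one ((v : C) ⊗ l) k ≫ (v : C) ◁ I.onb ⟨l, hl⟩ (I.sol v).conj i) ≫
          (v : C) ◁ dag (I.onb ⟨l, hl⟩ (I.sol v).conj i) := by
        rw [Category.assoc, ← whiskerLeft_comp, hi, whiskerLeft_id, Category.comp_id]
    _ = 0 := by rw [h, Limits.zero_comp]

/-- The component of `a a*` at the tensor unit is a positive scalar, and it vanishes only for
`a = 0`. -/
lemma exists_nonneg_cornerMul_cornerStar {x : C} (a : I.Corner x (𝟙_ C)) :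
    ∃ r : ℝ, 0 ≤ r ∧ (r = 0 → a = 0) ∧
      I.cornerMul a (I.cornerStar a) I.one = (r : ℂ) • 𝟙 (𝟙_ C ⊗ 𝟙_ C) := by
  classical
  choose r hr hr0 hrU using fun (m v l : I.carrier) (i : Fin (I.mult l (I.sol v).conj))
    (k : Fin (I.mult I.one ((m : C) ⊗ (l : C)))) => I.exists_nonneg_comp_tubeComp_tubeRot
      (I.onb I.one ((m : C) ⊗ (l : C)) k ≫ (m : C) ◁ I.onb l (I.sol v).conj i) a
  refine ⟨∑ m ∈ a.support, ∑ v ∈ a.support, ∑ l ∈ I.constituents (I.sol v).conj, ∑ i, ∑ k,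
    r m v l i k, ?_, fun h => ?_, ?_⟩
  · exact Finset.sum_nonneg fun m _ => Finset.sum_nonneg fun v _ => Finset.sum_nonneg fun l _ =>
      Finset.sum_nonneg fun i _ => Finset.sum_nonneg fun k _ => hr m v l i k
  · by_contra ha
    obtain ⟨v, hv⟩ : ∃ v, v ∈ a.support := by
      by_contra! h
      exact ha (DFinsupp.support_eq_empty.1 (Finset.eq_empty_of_forall_notMem h))
    -- The diagonal term `m = v` with this nonzero `U` detects `a v`. All terms are nonnegative, so
    -- a zero total forces this one to vanish, one level of summation at a time.
    obtain ⟨l, hl, i, k, hU⟩ := I.exists_onb_comp_onb_ne_zero v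
    have h5 : ∀ m v l i, 0 ≤ ∑ k, r m v l i k := fun m v l i =>
      Finset.sum_nonneg fun k _ => hr m v l i k
    have h4 : ∀ m v l, 0 ≤ ∑ i, ∑ k, r m v l i k := fun m v l =>
      Finset.sum_nonneg fun i _ => h5 m v l i
    have h3 : ∀ m v, 0 ≤ ∑ l ∈ I.constituents (I.sol v).conj, ∑ i, ∑ k, r m v l i k :=
      fun m v => Finset.sum_nonneg fun l _ => h4 m v l
    have h2 : ∀ m, 0 ≤ ∑ v ∈ a.support, ∑ l ∈ I.constituents (I.sol v).conj, ∑ i, ∑ k,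
        r m v l i k := fun m => Finset.sum_nonneg fun v _ => h3 m v
    rw [Finset.sum_eq_zero_iff_of_nonneg fun m _ => h2 m] at h
    have h := h v hv
    rw [Finset.sum_eq_zero_iff_of_nonneg fun v' _ => h3 v v'] at h
    have h := h v hv
    rw [Finset.sum_eq_zero_iff_of_nonneg fun l _ => h4 v v l] at h
    have h := h l hl
    rw [Finset.sum_eq_zero_iff_of_nonneg fun i _ => h5 v v l i] at h
    have h := h i (Finset.mem_univ _)
    rw [Finset.sum_eq_zero_iff_of_nonneg fun k _ => hr v v l i k] at h
    exact DFinsupp.mem_support_iff.1 hv (hr0 v v l i k rfl hU (h k (Finset.mem_univ _)))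
  · rw [cornerMul_cornerStar_apply]
    push_cast
    simp only [Finset.sum_smul]
    refine Finset.sum_congr rfl fun m _ => Finset.sum_congr rfl fun v _ =>
      Finset.sum_congr rfl fun l _ => Finset.sum_congr rfl fun i _ =>
      Finset.sum_congr rfl fun k _ => hrU m v l i k

/-! ### From the corners to the tube algebra and its cone -/

open Classical in
lemma cornerMul_zero_left {i s j : C} (b : I.Corner i s) :
    I.cornerMul (0 : I.Corner s j) b = 0 :=
  DFinsupp.sum_zero_index

open Classical in
lemma cornerMul_zero_right {i s j : C} (a : I.Corner s j) :
    I.cornerMul a (0 : I.Corner i s) = 0 :=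
  Finset.sum_eq_zero fun _ _ => DFinsupp.sum_zero_index

open Classical in
lemma cornerStar_zero {x y : C} : I.cornerStar (0 : I.Corner x y) = 0 :=
  DFinsupp.sum_zero_index

lemma star_incl {x y : I.carrier} (f : I.Corner (x : C) (y : C)) :
    star (I.incl x y f) = I.incl y x (I.cornerStar f) := by
  classical
  change DFinsupp.sum _ _ = _
  rw [incl, DFinsupp.lsingle_apply, DFinsupp.sum_single_index]
  rw [cornerStar_zero, map_zero]

lemma incl_mul_incl {x y z : I.carrier} (f : I.Corner (y : C) (z : C))
    (g : I.Corner (x : C) (y : C)) :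
    I.incl y z f * I.incl x y g = I.incl x z (I.cornerMul f g) := by
  classical
  change DFinsupp.sum _ _ = _
  rw [incl, DFinsupp.lsingle_apply, DFinsupp.sum_single_index]
  · rw [incl, DFinsupp.lsingle_apply, DFinsupp.sum_single_index]
    · simp
    · simp [cornerMul_zero_right]
  · simp [cornerMul_zero_left, DFinsupp.sum]

/-- The component at the tensor unit of the corner `A_{𝟙,𝟙}`. -/
noncomputable def unitComponent : I.TubeAlgebra →+ (𝟙_ C ⊗ 𝟙_ C ⟶ 𝟙_ C ⊗ 𝟙_ C) where
  toFun t := t (I.one, I.one) I.one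
  map_zero' := rfl
  map_add' _ _ := rfl

lemma unitComponent_mul_star {x : I.carrier} {a : I.TubeAlgebra} (ha : a ∈ I.corner x I.one) :
    ∃ r : ℝ, 0 ≤ r ∧ (r = 0 → a * star a = 0) ∧
      I.unitComponent (a * star a) = (r : ℂ) • 𝟙 (𝟙_ C ⊗ 𝟙_ C) := by
  classical
  obtain ⟨f, rfl⟩ := ha
  obtain ⟨r, hr, hr0, e⟩ := I.exists_nonneg_cornerMul_cornerStar f
  rw [star_incl, incl_mul_incl]
  refine ⟨r, hr, fun h => ?_, ?_⟩
  · have hf : f = 0 := hr0 h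
    rw [hf, cornerMul_zero_left, map_zero]
  · rw [← e]
    change (I.incl I.one I.one _) (I.one, I.one) I.one = _
    rw [incl, DFinsupp.lsingle_apply, DFinsupp.single_eq_same]
    rfl

/-- Nonnegative values cannot cancel: if they sum to zero, each is zero, and so is each summand `a
a*`. -/
lemma unitComponent_of_mem_tubeCone {t : I.TubeAlgebra} (ht : t ∈ I.tubeCone) :
    ∃ r : ℝ, 0 ≤ r ∧ (r = 0 → t = 0) ∧ I.unitComponent t = (r : ℂ) • 𝟙 (𝟙_ C ⊗ 𝟙_ C) := by
  obtain ⟨n, a, ha, rfl⟩ := ht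
  choose x hx using ha
  choose r hr hr0 e using fun i => I.unitComponent_mul_star (hx i)
  refine ⟨∑ i, r i, Finset.sum_nonneg fun i _ => hr i, fun h => ?_, ?_⟩
  · rw [Finset.sum_eq_zero_iff_of_nonneg fun i _ => hr i] at h
    exact Finset.sum_eq_zero fun i hi => hr0 i (h i hi)
  · rw [map_sum]
    push_cast
    rw [Finset.sum_smul]
    exact Finset.sum_congr rfl fun i _ => e i

lemma zero_mem_tubeCone : (0 : I.TubeAlgebra) ∈ I.tubeCone :=
  ⟨0, Fin.elim0, fun i => i.elim0, by simp⟩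

end Irr

end TubeCone

theorem mainTheorem5 {C : Type u} [Category.{v} C] [Preadditive C] [Linear ℂ C]
    [MonoidalCategory C] [MonoidalPreadditive C] [MonoidalLinear ℂ C]
    [TubeCone.CStarTensorCategory C] [TubeCone.IsRigidWithSimpleUnit C] (I : TubeCone.Irr C) :
    I.tubeCone ∩ (-I.tubeCone) = {0} := by
  refine Set.Subset.antisymm (fun t ht => ?_) ?_
  · obtain ⟨r, hr, hr0, e⟩ := I.unitComponent_of_mem_tubeCone ht.1
    obtain ⟨s, hs, -, e'⟩ := I.unitComponent_of_mem_tubeCone (Set.mem_neg.1 ht.2)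
    rw [map_neg, e] at e'
    -- The values `r` at `t` and `s` at `-t` are opposite, so `r + s` annihilates the nonzero
    -- identity of `𝟙 ⊗ 𝟙`.
    have h : ((r + s : ℝ) : ℂ) • 𝟙 (𝟙_ C ⊗ 𝟙_ C) = 0 := by
      push_cast
      rw [add_smul, ← e', add_neg_cancel]
    have h1 : 𝟙 (𝟙_ C ⊗ 𝟙_ C) ≠ 0 := by
      intro h0
      apply (TubeCone.simple_unit (C := C)).1
      rw [← (λ_ (𝟙_ C)).inv_hom_id, ← Category.id_comp (λ_ (𝟙_ C)).hom, h0]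
      simp
    have h2 : r + s = 0 := by exact_mod_cast (smul_eq_zero.1 h).resolve_right h1
    exact hr0 (by linarith)
  · rintro _ rfl
    exact ⟨I.zero_mem_tubeCone, by simpa using I.zero_mem_tubeCone⟩
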